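/- Let $\mathcal{O}$ be a Noetherian integrally closed domain with field of fractions $K$, and let $A$ be an $\mathcal{O}$-algebra which is free and finitely generated as an $\mathcal{O}$-module. A symmetrizing form on $A$ is an $\mathcal{O}$-linear map $t : A \to \mathcal{O}$ with $t(ab)=t(ba)$ such that $a \mapsto (x \mapsto t(ax))$ is an isomorphism $A \to \mathrm{Hom}_{\mathcal{O}}(A,\mathcal{O})$. Let $t$ be a symmetrizing form on $A$, let $G$ be a finite cyclic group, and let $(A,t)$ be a twisted symmetric algebra of $G$ over a subalgebra $\bar A$; that is: (i) $\bar A$ is free of finite rank over $\mathcal{O}$, $t|_{\bar A}$ is a symmetrizing form on $\bar A$, and $A$ is free of finite rank as a left $\bar A$-module; (ii) there are given $\mathcal{O}$-submodules $(A_g)_{g\in G}$ of $A$ with $A=\bigoplus_{g\in G}A_g$, $A_gA_h=A_{gh}$ for all $g,h \in G$, $A_1=\bar A$, $t(A_g)=0$ for $g\neq 1$, and $A_g\cap A^\times\neq\emptyset$ for all $g \in G$. Assume that the algebras $KA=K\otimes_{\mathcal{O}}A$, $K\bar A=K\otimes_{\mathcal{O}}\bar A$ and $KG$ are split semisimple over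 $K$ (semisimple, with $\mathrm{End}(V)\simeq K$ for every simple module $V$). For a ring $R$ with center $ZR$, a block of $R$ is a primitive idempotent of $ZR$, i.e. a non-zero central idempotent which is not a sum of two non-zero orthogonal central idempotents; $\mathrm{Bl}(R)$ is the set of blocks of $R$. The group $G$ acts on $Z\bar A$ by ring automorphisms, $g(\bar a)$ being the unique element with $g(\bar a)x=x\bar a$ for all $x\in A_g$, and hence on $\mathrm{Bl}(\bar A)$. The group $G^\vee=\mathrm{Hom}(G,K^\times)$, whose elements take values in $\mathcal{O}^\times$, acts on $A$ by algebra automorphisms, $\xi\cdot x=\xi(g)x$ for $x\in A_g$, and hence on $\mathrm{Bl}(A)$. For $\bar b\in\mathrm{Bl}(\bar A)$ and $b\in\mathrm{Bl}(A)$, with stabilizers $G_{\bar b}$ and $(G^\vee)_b$, put $$\mathrm{Tr}(G,\bar b)=\sum_{g\in G/G_{\bar b}}g(\bar b),\qquad \mathrm{Tr}(G^\vee,b)=\sum_{\xi\in G^\vee/(G^\vee)_b}\xi\cdot b .$$ Then: (1) There is a bijection $\mathrm{Bl}(\bar A)/G\leftrightarrow\mathrm{Bl}(A)/G^\vee$,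 $\bar{\mathcal{Y}}\leftrightarrow\mathcal{Y}$, between orbit sets such that $\sum_{\bar b\in\bar{\mathcal{Y}}}\bar b=\sum_{b\in\mathcal{Y}}b$, i.e. $\mathrm{Tr}(G,\bar b)=\mathrm{Tr}(G^\vee,b)$ for all $\bar b\in\bar{\mathcal{Y}}$ and $b\in\mathcal{Y}$. (2) The algebras $(Z\bar A)^G$ and $(ZA)^{G^\vee}$ have the same blocks (as elements of $A$). (3) If every block of $A$ is fixed by $G^\vee$, then the blocks of $A$ coincide with the blocks of $(Z\bar A)^G$. -/

import Mathlib

open scoped TensorProduct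

/-- A block (block-idempotent) of `R`: a non-zero central idempotent which is not the sum of two
non-zero orthogonal central idempotents. -/
structure IsBlock {R : Type*} [Semiring R] (e : R) : Prop where
  idem : e * e = e
  central : e ∈ Set.center R
  ne_zero : e ≠ 0
  primitive : ∀ e₁ e₂ : R, e₁ ∈ Set.center R → e₂ ∈ Set.center R → e₁ * e₁ = e₁ → e₂ * e₂ = e₂ →
    e₁ * e₂ = 0 → e = e₁ + e₂ → e₁ = 0 ∨ e₂ = 0

/-- A `K`-algebra `B` is split semisimple if it is semisimple and `End_B(V) ≃ K` for every simple
`B`-module `V`. (Every simple module is a quotient of `B`, so the universe of `B` suffices.) -/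
def IsSplitSemisimple.{u, v} (K : Type u) [Field K] (B : Type v) [Ring B] [Algebra K B] : Prop :=
  IsSemisimpleRing B ∧
    ∀ (V : Type v) [AddCommGroup V] [Module K V] [Module B V] [IsScalarTower K B V]
      [IsSimpleModule B V], Nonempty (Module.End B V ≃ₐ[K] K)

/-- A symmetrizing form: a trace function `t` such that `a ↦ (x ↦ t (a x))` is an isomorphism from
`A` to its `O`-dual. (This map is a morphism of bimodules for every trace function `t`.) -/
structure IsSymmetrizingForm {O A : Type*} [CommRing O] [Ring A] [Algebra O A]
    (t : A →ₗ[O] O) : Prop where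
  trace : ∀ a b : A, t (a * b) = t (b * a)
  bijective : Function.Bijective fun a : A => t ∘ₗ LinearMap.mulLeft O a

/-- `S` is a symmetric subalgebra of `(A, t)`. -/
structure IsSymmetricSubalgebra {O A : Type*} [CommRing O] [Ring A] [Algebra O A]
    (t : A →ₗ[O] O) (S : Subalgebra O A) : Prop where
  free : Module.Free O S
  finite : Module.Finite O S
  form : IsSymmetrizingForm (t ∘ₗ S.val.toLinearMap)
  free_left : Module.Free S A
  finite_left : Module.Finite S A

/-- The structure of a twisted symmetric algebra of the group `G` on the `O`-algebra `A`:
a symmetrizing form `t`, the subalgebra `bar` (written `Ā` below), and the family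
`comp g = A_g` of submodules. -/
structure TwistedSymmetricAlgebra (O G A : Type*) [CommRing O] [Group G] [DecidableEq G]
    [Ring A] [Algebra O A] where
  t : A →ₗ[O] O
  symmetrizing : IsSymmetrizingForm t
  bar : Subalgebra O A
  symmetric_bar : IsSymmetricSubalgebra t bar
  comp : G → Submodule O A
  internal : DirectSum.IsInternal comp
  comp_mul : ∀ g h : G, comp g * comp h = comp (g * h)
  comp_one : comp 1 = Subalgebra.toSubmodule bar
  t_comp : ∀ g : G, g ≠ 1 → ∀ a ∈ comp g, t a = 0
  exists_unit : ∀ g : G, ∃ u : Aˣ, (u : A) ∈ comp g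

/-- The value of a character `ξ : G → Kˣ` of a finite group lies in `O` if `O` is integrally closed
in `K`. -/
theorem exists_charVal {O K G : Type*} [CommRing O] [IsIntegrallyClosed O] [Field K]
    [Algebra O K] [IsFractionRing O K] [Group G] [Finite G] (ξ : G →* Kˣ) (g : G) :
    ∃ c : O, algebraMap O K c = (ξ g : K) := by
  apply IsIntegrallyClosed.isIntegral_iff.mp
  have h : ((ξ g : Kˣ) : K) ^ Nat.card G = 1 := by
    rw [← Units.val_pow_eq_pow_val, ← map_pow, pow_card_eq_one']
    simp
  exact IsIntegral.of_pow Nat.card_pos (h ▸ isIntegral_one)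

/-- The element of `O` whose image in `K` is `ξ g`. -/
noncomputable def charVal (O : Type*) {K G : Type*} [CommRing O] [IsIntegrallyClosed O] [Field K]
    [Algebra O K] [IsFractionRing O K] [Group G] [Finite G] (ξ : G →* Kˣ) (g : G) : O :=
  (exists_charVal (O := O) ξ g).choose

theorem algebraMap_charVal {O K G : Type*} [CommRing O] [IsIntegrallyClosed O] [Field K]
    [Algebra O K] [IsFractionRing O K] [Group G] [Finite G] (ξ : G →* Kˣ) (g : G) :
    algebraMap O K (charVal O ξ g) = (ξ g : K) :=
  (exists_charVal (O := O) ξ g).choose_spec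

section CharVal

variable {O K G : Type*} [CommRing O] [IsIntegrallyClosed O] [Field K] [Algebra O K]
  [IsFractionRing O K] [Group G] [Finite G]

theorem charVal_mul (ξ : G →* Kˣ) (g h : G) :
    charVal O ξ (g * h) = charVal O ξ g * charVal O ξ h := by
  apply IsFractionRing.injective O K
  simp [algebraMap_charVal]

theorem charVal_one (ξ : G →* Kˣ) : charVal O ξ 1 = 1 := by
  apply IsFractionRing.injective O K
  simp [algebraMap_charVal]

theorem charVal_mul_char (ξ ψ : G →* Kˣ) (g : G) :
    charVal O (ξ * ψ) g = charVal O ξ g * charVal O ψ g := by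
  apply IsFractionRing.injective O K
  simp [algebraMap_charVal]

theorem charVal_one_char (g : G) : charVal O (1 : G →* Kˣ) g = 1 := by
  apply IsFractionRing.injective O K
  simp [algebraMap_charVal]

end CharVal

namespace TwistedSymmetricAlgebra

section Bar

variable {O G A : Type*} [CommRing O] [Group G] [DecidableEq G] [Ring A] [Algebra O A]
  (D : TwistedSymmetricAlgebra O G A)

theorem mem_comp_one {a : A} : a ∈ D.comp 1 ↔ a ∈ D.bar := by
  rw [D.comp_one, Subalgebra.mem_toSubmodule]

theorem mul_mem_comp {g h : G} {a b : A} (ha : a ∈ D.comp g) (hb : b ∈ D.comp h) :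
    a * b ∈ D.comp (g * h) := by
  rw [← D.comp_mul]
  exact Submodule.mul_mem_mul ha hb

theorem inv_mem_comp {g : G} {u : Aˣ} (hu : (u : A) ∈ D.comp g) :
    ((u⁻¹ : Aˣ) : A) ∈ D.comp g⁻¹ := by
  let 𝒜 : Additive G → Submodule O A := fun i => D.comp i.toMul
  let : DecidableEq (Additive G) := inferInstanceAs (DecidableEq G)
  have hI : DirectSum.IsInternal 𝒜 := D.internal
  let : DirectSum.Decomposition 𝒜 := hI.chooseDecomposition
  let : GradedRing 𝒜 :=
    { one_mem := (D.mem_comp_one).2 D.bar.one_mem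
      mul_mem := fun _ _ _ _ ha hb => D.mul_mem_comp ha hb }
  let i : Additive G := Additive.ofMul g
  have hu' : (u : A) ∈ 𝒜 i := hu
  have h1 : (1 : A) ∈ 𝒜 (i + -i) := by
    rw [add_neg_cancel]
    exact SetLike.GradedOne.one_mem
  have key := DirectSum.coe_decompose_mul_add_of_left_mem 𝒜 (i := i) (j := -i)
    (b := ((u⁻¹ : Aˣ) : A)) hu'
  rw [Units.mul_inv, DirectSum.decompose_of_mem_same 𝒜 h1] at key
  have : ((u⁻¹ : Aˣ) : A) = DirectSum.decompose 𝒜 ((u⁻¹ : Aˣ) : A) (-i) :=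
    Units.inv_eq_of_mul_eq_one_right key.symm
  rw [this]
  exact (DirectSum.decompose 𝒜 ((u⁻¹ : Aˣ) : A) (-i)).2

theorem exists_act (g : G) (z : Subalgebra.center O D.bar) :
    ∃ y : Subalgebra.center O D.bar, ∀ x ∈ D.comp g,
      ((y : D.bar) : A) * x = x * ((z : D.bar) : A) := by
  obtain ⟨u, hu⟩ := D.exists_unit g
  have hu' := D.inv_mem_comp hu
  have hz : ∀ w ∈ D.bar, w * ((z : D.bar) : A) = ((z : D.bar) : A) * w := fun w hw =>
    congrArg Subtype.val (Subalgebra.mem_center_iff.1 z.2 ⟨w, hw⟩)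
  have hy : (u : A) * ((z : D.bar) : A) * ((u⁻¹ : Aˣ) : A) ∈ D.bar := by
    rw [← D.mem_comp_one]
    have := D.mul_mem_comp (D.mul_mem_comp hu ((D.mem_comp_one).2 (z : D.bar).2)) hu'
    simpa using this
  refine ⟨⟨⟨_, hy⟩, Subalgebra.mem_center_iff.2 fun w => Subtype.ext ?_⟩, fun x hx => ?_⟩
  · have hw : ((u⁻¹ : Aˣ) : A) * w * u ∈ D.bar := by
      rw [← D.mem_comp_one]
      have := D.mul_mem_comp (D.mul_mem_comp hu' ((D.mem_comp_one).2 w.2)) hu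
      simpa using this
    have := congrArg (fun a => (u : A) * a * ((u⁻¹ : Aˣ) : A)) (hz _ hw)
    simpa [mul_assoc] using this
  · have hx' : ((u⁻¹ : Aˣ) : A) * x ∈ D.bar := by
      rw [← D.mem_comp_one]
      simpa using D.mul_mem_comp hu' hx
    have := congrArg (fun a => (u : A) * a) (hz _ hx')
    simpa [mul_assoc] using this.symm

theorem comp_induction {p : A → Prop} (h0 : p 0) (hadd : ∀ a b, p a → p b → p (a + b))
    (hc : ∀ g, ∀ a ∈ D.comp g, p a) (a : A) : p a := by
  have ha : a ∈ ⨆ g, D.comp g := by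
    rw [D.internal.submodule_iSup_eq_top]
    trivial
  exact Submodule.iSup_induction D.comp (motive := p) ha hc h0 hadd

/-- For `z ∈ ZĀ`, the unique element `g(z)` with `g(z) x = x z` for all `x ∈ A_g`. -/
noncomputable def act (g : G) (z : Subalgebra.center O D.bar) : Subalgebra.center O D.bar :=
  (D.exists_act g z).choose

theorem act_mul {g : G} (z : Subalgebra.center O D.bar) {x : A} (hx : x ∈ D.comp g) :
    ((D.act g z : D.bar) : A) * x = x * ((z : D.bar) : A) :=
  (D.exists_act g z).choose_spec x hx

theorem act_unique {g : G} {z y : Subalgebra.center O D.bar} {u : Aˣ}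
    (hu : (u : A) ∈ D.comp g) (h : ((y : D.bar) : A) * u = u * ((z : D.bar) : A)) :
    D.act g z = y := by
  apply Subtype.ext
  apply Subtype.ext
  exact u.isUnit.mul_right_cancel ((D.act_mul z hu).trans h.symm)

/-- The action of `G` on `ZĀ` by ring automorphisms. -/
noncomputable instance : MulSemiringAction G (Subalgebra.center O D.bar) where
  smul := D.act
  one_smul z := by
    refine D.act_unique (u := 1) ((D.mem_comp_one).2 D.bar.one_mem) ?_
    simp
  mul_smul g h z := by
    obtain ⟨u, hu⟩ := D.exists_unit g
    obtain ⟨v, hv⟩ := D.exists_unit h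
    refine D.act_unique (u := u * v) (D.mul_mem_comp hu hv) ?_
    change ((D.act g (D.act h z) : D.bar) : A) * _ = _
    rw [Units.val_mul, ← mul_assoc, D.act_mul _ hu, mul_assoc, D.act_mul _ hv, mul_assoc]
  smul_zero g := by
    obtain ⟨u, hu⟩ := D.exists_unit g
    exact D.act_unique hu (by simp)
  smul_add g x y := by
    obtain ⟨u, hu⟩ := D.exists_unit g
    refine D.act_unique hu ?_
    change (((D.act g x + D.act g y : Subalgebra.center O D.bar) : D.bar) : A) * _ = _
    simp [add_mul, mul_add, D.act_mul _ hu]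
  smul_one g := by
    obtain ⟨u, hu⟩ := D.exists_unit g
    exact D.act_unique hu (by simp)
  smul_mul g x y := by
    obtain ⟨u, hu⟩ := D.exists_unit g
    refine D.act_unique hu ?_
    change (((D.act g x * D.act g y : Subalgebra.center O D.bar) : D.bar) : A) * _ = _
    rw [mul_comm (D.act g x)]
    simp only [MulMemClass.coe_mul]
    rw [mul_assoc, D.act_mul _ hu, ← mul_assoc, D.act_mul _ hu, mul_assoc,
      ← MulMemClass.coe_mul, ← MulMemClass.coe_mul, ← MulMemClass.coe_mul,
      ← MulMemClass.coe_mul, mul_comm]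

/-- The subalgebra `(ZĀ)^G` of `ZĀ`. -/
def fixedBar : Subalgebra O (Subalgebra.center O D.bar) where
  carrier := {z | ∀ g : G, g • z = z}
  mul_mem' hx hy g := by rw [smul_mul', hx g, hy g]
  add_mem' hx hy g := by rw [smul_add, hx g, hy g]
  algebraMap_mem' r g := by
    obtain ⟨u, hu⟩ := D.exists_unit g
    exact D.act_unique hu (Algebra.commutes r (u : A))

/-- `Bl(Ā)`. -/
def BarBlocks : Type _ := {b : D.bar // IsBlock b}

end Bar

end TwistedSymmetricAlgebra

/-- A block of `R`, seen in the center, is a primitive idempotent there; so ring automorphisms of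
the center permute the blocks. -/
theorem IsBlock.map_center {O R : Type*} [CommRing O] [Ring R] [Algebra O R]
    (σ : Subalgebra.center O R ≃+* Subalgebra.center O R) {b : R} (hb : IsBlock b)
    (hc : b ∈ Subalgebra.center O R) : IsBlock (σ ⟨b, hc⟩ : R) where
  idem := by
    have : (⟨b, hc⟩ : Subalgebra.center O R) * ⟨b, hc⟩ = ⟨b, hc⟩ := Subtype.ext hb.idem
    rw [← MulMemClass.coe_mul, ← map_mul, this]
  central := (σ ⟨b, hc⟩).2
  ne_zero h := by
    have h0 : σ ⟨b, hc⟩ = 0 := Subtype.ext h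
    rw [map_eq_zero_iff σ σ.injective] at h0
    exact hb.ne_zero (congrArg Subtype.val h0)
  primitive e₁ e₂ h₁ h₂ i₁ i₂ o s := by
    let f₁ : Subalgebra.center O R := ⟨e₁, h₁⟩
    let f₂ : Subalgebra.center O R := ⟨e₂, h₂⟩
    have i₁' : f₁ * f₁ = f₁ := Subtype.ext i₁
    have i₂' : f₂ * f₂ = f₂ := Subtype.ext i₂
    have o' : f₁ * f₂ = 0 := Subtype.ext o
    have s' : σ ⟨b, hc⟩ = f₁ + f₂ := Subtype.ext s
    have s'' : (⟨b, hc⟩ : Subalgebra.center O R) = σ.symm f₁ + σ.symm f₂ := by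
      rw [← map_add, ← s', RingEquiv.symm_apply_apply]
    have := hb.primitive (σ.symm f₁ : R) (σ.symm f₂ : R) (σ.symm f₁).2 (σ.symm f₂).2
      (by rw [← MulMemClass.coe_mul, ← map_mul, i₁']) (by rw [← MulMemClass.coe_mul, ← map_mul, i₂'])
      (by rw [← MulMemClass.coe_mul, ← map_mul, o', map_zero]; rfl) (congrArg Subtype.val s'')
    refine this.imp (fun h => ?_) (fun h => ?_)
    · have h0 : σ.symm f₁ = 0 := Subtype.ext h
      rw [map_eq_zero_iff _ σ.symm.injective] at h0
      exact congrArg Subtype.val h0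
    · have h0 : σ.symm f₂ = 0 := Subtype.ext h
      rw [map_eq_zero_iff _ σ.symm.injective] at h0
      exact congrArg Subtype.val h0

theorem IsBlock.map_equiv {R : Type*} [Ring R] (σ : R ≃+* R) {b : R} (hb : IsBlock b) :
    IsBlock (σ b) := by
  have hcen : ∀ (τ : R ≃+* R) {z : R}, z ∈ Set.center R → τ z ∈ Set.center R := fun τ z hz => by
    rw [Semigroup.mem_center_iff] at hz ⊢
    intro x
    have := congrArg τ (hz (τ.symm x))
    simpa using this
  refine ⟨by rw [← map_mul, hb.idem], hcen σ hb.central, ?_, ?_⟩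
  · rw [Ne, map_eq_zero_iff σ σ.injective]
    exact hb.ne_zero
  · intro e₁ e₂ h₁ h₂ i₁ i₂ o s
    have := hb.primitive (σ.symm e₁) (σ.symm e₂) (hcen _ h₁) (hcen _ h₂) (by rw [← map_mul, i₁])
      (by rw [← map_mul, i₂]) (by rw [← map_mul, o, map_zero])
      (by rw [← map_add, ← s, RingEquiv.symm_apply_apply])
    simpa using this

namespace TwistedSymmetricAlgebra

section BarBlocks

variable {O G A : Type*} [CommRing O] [Group G] [DecidableEq G] [Ring A] [Algebra O A]
  (D : TwistedSymmetricAlgebra O G A)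

/-- A block of `Ā` as an element of `ZĀ`. -/
def BarBlocks.toCenter {D : TwistedSymmetricAlgebra O G A} (b : D.BarBlocks) :
    Subalgebra.center O D.bar :=
  ⟨b.1, b.2.central⟩

/-- A block of `Ā` as an element of `A`. -/
def BarBlocks.val {D : TwistedSymmetricAlgebra O G A} (b : D.BarBlocks) : A :=
  (b.1 : A)

/-- The action of `G` on `Bl(Ā)`, `b ↦ g(b)`. -/
noncomputable instance : MulAction G D.BarBlocks where
  smul g b := ⟨((g • b.toCenter : Subalgebra.center O D.bar) : D.bar),
    b.2.map_center (MulSemiringAction.toRingEquiv G (Subalgebra.center O D.bar) g) b.2.central⟩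
  one_smul b := by
    apply Subtype.ext
    exact congrArg (fun z : Subalgebra.center O D.bar => (z : D.bar)) (one_smul G b.toCenter)
  mul_smul g h b := by
    apply Subtype.ext
    exact congrArg (fun z : Subalgebra.center O D.bar => (z : D.bar)) (mul_smul g h b.toCenter)

end BarBlocks

section Dual

variable {O G A : Type*} [CommRing O] [Group G] [DecidableEq G] [Ring A] [Algebra O A]
  (D : TwistedSymmetricAlgebra O G A)
  {K : Type*} [IsIntegrallyClosed O] [Field K] [Algebra O K] [IsFractionRing O K] [Finite G]

/-- The `O`-linear operator on `A` given by `ξ · a = ξ(g) a` for `a ∈ A_g`. -/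
noncomputable def dualLin (ξ : G →* Kˣ) : A →ₗ[O] A :=
  (DirectSum.toModule O G A fun g => charVal O ξ g • (D.comp g).subtype) ∘ₗ
    ((LinearEquiv.ofBijective (DirectSum.coeLinearMap D.comp) D.internal).symm :
      A →ₗ[O] DirectSum G fun g => D.comp g)

theorem dualLin_apply (ξ : G →* Kˣ) {g : G} {a : A} (ha : a ∈ D.comp g) :
    D.dualLin ξ a = charVal O ξ g • a := by
  have : (LinearEquiv.ofBijective (DirectSum.coeLinearMap D.comp) D.internal).symm a =
      DirectSum.lof O G (fun g => D.comp g) g ⟨a, ha⟩ := by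
    rw [LinearEquiv.symm_apply_eq]
    exact (DirectSum.coeLinearMap_lof D.comp g ⟨a, ha⟩).symm
  simp [dualLin, this, DirectSum.toModule_lof]

theorem dualLin_one_char (a : A) : D.dualLin (1 : G →* Kˣ) a = a := by
  induction a using D.comp_induction with
  | h0 => simp
  | hadd a b ha hb => rw [map_add, ha, hb]
  | hc g a ha => rw [D.dualLin_apply _ ha, charVal_one_char, one_smul]

theorem dualLin_mul_char (ξ ψ : G →* Kˣ) (a : A) :
    D.dualLin (ξ * ψ) a = D.dualLin ξ (D.dualLin ψ a) := by
  induction a using D.comp_induction with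
  | h0 => simp
  | hadd a b ha hb => rw [map_add, map_add, map_add, ha, hb]
  | hc g a ha =>
    rw [D.dualLin_apply _ ha, D.dualLin_apply _ ha, map_smul, D.dualLin_apply _ ha,
      charVal_mul_char, smul_smul, mul_comm]

theorem dualLin_mul (ξ : G →* Kˣ) (a b : A) :
    D.dualLin ξ (a * b) = D.dualLin ξ a * D.dualLin ξ b := by
  induction a using D.comp_induction with
  | h0 => simp
  | hadd a a' ha ha' => rw [add_mul, map_add, map_add, ha, ha', add_mul]
  | hc g a ha =>
    induction b using D.comp_induction with
    | h0 => simp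
    | hadd b b' hb hb' => rw [mul_add, map_add, map_add, hb, hb', mul_add]
    | hc h b hb =>
      rw [D.dualLin_apply _ ha, D.dualLin_apply _ hb, D.dualLin_apply _ (D.mul_mem_comp ha hb),
        charVal_mul, smul_mul_smul_comm]

theorem dualLin_algebraMap (ξ : G →* Kˣ) (r : O) :
    D.dualLin ξ (algebraMap O A r) = algebraMap O A r := by
  rw [D.dualLin_apply ξ ((D.mem_comp_one).2 (D.bar.algebraMap_mem r)), charVal_one, one_smul]

/-- The automorphism `a ↦ ξ · a` of the algebra `A`. -/
noncomputable def dualAct (ξ : G →* Kˣ) : A ≃ₐ[O] A :=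
  AlgEquiv.ofAlgHom
    (AlgHom.ofLinearMap (D.dualLin ξ)
      (by simpa using D.dualLin_algebraMap ξ 1) (D.dualLin_mul ξ))
    (AlgHom.ofLinearMap (D.dualLin ξ⁻¹)
      (by simpa using D.dualLin_algebraMap ξ⁻¹ 1) (D.dualLin_mul ξ⁻¹))
    (by
      ext a
      change D.dualLin ξ (D.dualLin ξ⁻¹ a) = a
      rw [← D.dualLin_mul_char, show ξ * ξ⁻¹ = 1 by ext; simp, D.dualLin_one_char])
    (by
      ext a
      change D.dualLin ξ⁻¹ (D.dualLin ξ a) = a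
      rw [← D.dualLin_mul_char, show ξ⁻¹ * ξ = 1 by ext; simp, D.dualLin_one_char])

variable (K) in
/-- The subalgebra `(ZA)^{G^∨}` of `A`, where `G^∨ = Hom(G, Kˣ)`. -/
def fixedTop : Subalgebra O A where
  carrier := {z | z ∈ Subalgebra.center O A ∧ ∀ ξ : G →* Kˣ, D.dualAct ξ z = z}
  mul_mem' hx hy := ⟨mul_mem hx.1 hy.1, fun ξ => by rw [map_mul, hx.2 ξ, hy.2 ξ]⟩
  add_mem' hx hy := ⟨add_mem hx.1 hy.1, fun ξ => by rw [map_add, hx.2 ξ, hy.2 ξ]⟩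
  algebraMap_mem' r := ⟨Subalgebra.algebraMap_mem _ r, fun ξ => AlgEquiv.commutes _ r⟩

end Dual

/-- `Bl(A)`. (The structure `D` is recorded because the action of `G^∨` depends on it.) -/
def Blocks {O G A : Type*} [CommRing O] [Group G] [DecidableEq G] [Ring A] [Algebra O A]
    (_D : TwistedSymmetricAlgebra O G A) : Type _ :=
  {b : A // IsBlock b}

section Trace

variable {O G A : Type*} [CommRing O] [Group G] [DecidableEq G] [Ring A] [Algebra O A]
  (D : TwistedSymmetricAlgebra O G A)

/-- A block of `A` as an element of `A`. -/
def Blocks.val {D : TwistedSymmetricAlgebra O G A} (b : D.Blocks) : A := b.1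

/-- The action of `G^∨ = Hom(G, Kˣ)` on `Bl(A)`, `b ↦ ξ · b`. -/
noncomputable instance {K : Type*} [IsIntegrallyClosed O] [Field K] [Algebra O K]
    [IsFractionRing O K] [Finite G] : MulAction (G →* Kˣ) D.Blocks where
  smul ξ b := ⟨D.dualAct ξ b.1, b.2.map_equiv (D.dualAct ξ).toRingEquiv⟩
  one_smul b := Subtype.ext (D.dualLin_one_char b.1)
  mul_smul ξ ψ b := Subtype.ext (D.dualLin_mul_char ξ ψ b.1)

/-- `Tr(G, b̄) = ∑_{g ∈ G/G_b̄} g(b̄)`, as an element of `A`. -/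
noncomputable def barTr (b : D.BarBlocks) : A :=
  ∑ᶠ q : G ⧸ MulAction.stabilizer G b, (MulAction.ofQuotientStabilizer G b q).val

variable (K : Type*) [IsIntegrallyClosed O] [Field K] [Algebra O K] [IsFractionRing O K] [Finite G]

/-- `Tr(G^∨, b) = ∑_{ξ ∈ G^∨/(G^∨)_b} ξ · b`. -/
noncomputable def topTr (b : D.Blocks) : A :=
  ∑ᶠ q : (G →* Kˣ) ⧸ MulAction.stabilizer (G →* Kˣ) b,
    (MulAction.ofQuotientStabilizer (G →* Kˣ) b q).val

end Trace

end TwistedSymmetricAlgebra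

/-!
Both rings of invariants are one and the same ring, `ZA ∩ Ā`. Indeed `z ∈ ZĀ` is fixed by `G` if and
only if it commutes with every `A_g`, that is, with `A`; and, since `KG` is split semisimple, the
characters in `G^∨` separate the elements of `G`, so that an element of `A` is fixed by `G^∨` if and
only if it lies in `A_1 = Ā`. On the other hand, when a finite group acts on a ring, a central
idempotent that is fixed by the group and does not annihilate a block contains the whole orbit of
that block, so the blocks of the ring of central invariants are the orbit sums of blocks. Applied to
`G` acting on `ZĀ` and to `G^∨` acting on `A`, this puts both sets of orbits in bijection with the
blocks of `ZA ∩ Ā`.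
-/

section Idempotents

theorem isBlock_map_iff {R R' : Type*} [Semiring R] [Semiring R'] {ι : R' →+* R}
    (hι : Function.Injective ι) (hcenter : ι '' Set.center R' = Set.center R) {x : R'} :
    IsBlock (ι x) ↔ IsBlock x := by
  have mem_iff {y : R'} : ι y ∈ Set.center R ↔ y ∈ Set.center R' := by
    rw [← hcenter, hι.mem_set_image]
  constructor
  · intro h
    refine ⟨hι (by rw [map_mul, h.idem]), mem_iff.1 h.central, ne_zero_of_map h.ne_zero,
      fun e₁ e₂ c₁ c₂ i₁ i₂ horth hsum => ?_⟩
    have := h.primitive (ι e₁) (ι e₂) (mem_iff.2 c₁) (mem_iff.2 c₂) (by rw [← map_mul, i₁])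
      (by rw [← map_mul, i₂]) (by rw [← map_mul, horth, map_zero]) (by rw [hsum, map_add])
    simpa only [map_eq_zero_iff ι hι] using this
  · intro h
    refine ⟨by rw [← map_mul, h.idem], mem_iff.2 h.central, (map_ne_zero_iff ι hι).2 h.ne_zero,
      fun e₁ e₂ c₁ c₂ i₁ i₂ horth hsum => ?_⟩
    rw [← hcenter] at c₁ c₂
    obtain ⟨f₁, hf₁, rfl⟩ := c₁
    obtain ⟨f₂, hf₂, rfl⟩ := c₂
    simpa only [map_eq_zero_iff ι hι] using h.primitive f₁ f₂ hf₁ hf₂ (hι (by rw [map_mul, i₁]))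
      (hι (by rw [map_mul, i₂])) (hι (by rw [map_mul, horth, map_zero]))
      (hι (by rw [hsum, map_add]))

theorem isBlock_ringEquiv_iff {R R' : Type*} [Semiring R] [Semiring R'] (σ : R' ≃+* R) {x : R'} :
    IsBlock (σ x) ↔ IsBlock x := by
  refine isBlock_map_iff (ι := (σ : R' →+* R)) σ.injective (Set.ext fun y => ?_)
  refine ⟨?_, fun hy => ⟨σ.symm y, MulEquivClass.apply_mem_center σ.symm hy, σ.apply_symm_apply y⟩⟩
  rintro ⟨x, hx, rfl⟩
  exact MulEquivClass.apply_mem_center σ hx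

variable {R : Type*} [Ring R] {b c e : R}

theorem IsBlock.commute (hb : IsBlock b) (x : R) : Commute b x :=
  (Set.mem_center_iff.1 hb.central).comm x

theorem IsBlock.mul_eq_zero_or_mul_eq_self (hb : IsBlock b) (he : e ∈ Set.center R)
    (hi : IsIdempotentElem e) : b * e = 0 ∨ b * e = b := by
  have hidem {x : R} (hx : IsIdempotentElem x) : IsIdempotentElem (b * x) :=
    IsIdempotentElem.mul_of_commute (hb.commute x) hb.idem hx
  have hcompl : 1 - e ∈ Set.center R := sub_mem (one_mem (Subring.center R)) he
  have horth : b * e * (b * (1 - e)) = 0 := by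
    rw [(hb.commute e).symm.mul_mul_mul_comm, hi.mul_one_sub_self, mul_zero]
  refine (hb.primitive (b * e) (b * (1 - e)) (Set.mul_mem_center hb.central he)
    (Set.mul_mem_center hb.central hcompl) (hidem hi) (hidem hi.one_sub) horth
    (by rw [← mul_add, add_sub_cancel, mul_one])).imp id fun h => ?_
  rw [mul_sub, mul_one, sub_eq_zero] at h
  exact h.symm

theorem IsBlock.mul_eq_zero_of_ne (hb : IsBlock b) (hc : IsBlock c) (hbc : b ≠ c) :
    b * c = 0 := by
  rcases hb.mul_eq_zero_or_mul_eq_self hc.central hc.idem with h | hb'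
  · exact h
  · rcases hc.mul_eq_zero_or_mul_eq_self hb.central hb.idem with h | hc'
    · rw [(hb.commute c).eq, h]
    · exact absurd (by rw [← hb', (hb.commute c).eq, hc']) hbc

theorem isBlock_coe_center_iff {O : Type*} [CommRing O] [Algebra O R]
    {z : Subalgebra.center O R} : IsBlock (z : R) ↔ IsBlock z := by
  refine isBlock_map_iff (ι := (Subalgebra.center O R).val.toRingHom) Subtype.val_injective ?_
  rw [Set.center_eq_univ, Set.image_univ]
  exact Subtype.range_coe

theorem isBlock_of_forall_mul_eq_self (hc : e ∈ Set.center R) (hi : IsIdempotentElem e)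
    (h0 : e ≠ 0) (hmin : ∀ f ∈ Set.center R, IsIdempotentElem f → f ≠ 0 → f * e = f → f = e) :
    IsBlock e := by
  refine ⟨hi, hc, h0, fun e₁ e₂ c₁ _ i₁ _ horth hsum => or_iff_not_imp_left.2 fun h₁ => ?_⟩
  have he₁ : e₁ = e := hmin e₁ c₁ i₁ h₁ (by rw [hsum, mul_add, i₁, horth, add_zero])
  exact left_eq_add.1 (he₁.trans hsum)

variable (R) in
/-- The Boolean algebra of central idempotents of `R` is atomic, its atoms being the blocks of `R`.
This is the only chain condition needed for the correspondence between orbits of blocks and blocks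
of invariants. -/
def BlockAtomic : Prop :=
  ∀ e ∈ Set.center R, IsIdempotentElem e → e ≠ 0 → ∃ b, IsBlock b ∧ b * e = b

theorem BlockAtomic.of_injective {T : Type*} [Ring T] [IsNoetherianRing T] {j : R →+* T}
    (hj : Function.Injective j) : BlockAtomic R := by
  intro e he hi h0
  let S : Set R := {f | f ∈ Set.center R ∧ IsIdempotentElem f ∧ f ≠ 0 ∧ f * e = f}
  obtain ⟨f, ⟨hfc, hfi, hf0, hfe⟩, hmax⟩ := exists_maximalFor_of_wellFoundedGT (· ∈ S)
    (fun f => Ideal.span {j (1 - f)}) ⟨e, he, hi, h0, hi⟩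
  refine ⟨f, isBlock_of_forall_mul_eq_self hfc hfi hf0 fun f' hfc' hfi' hf0' hff' => ?_, hfe⟩
  have hcomm : f * f' = f' := ((Set.mem_center_iff.1 hfc).comm f').eq.trans hff'
  have hle : Ideal.span {j (1 - f)} ≤ Ideal.span {j (1 - f')} :=
    (Ideal.span_singleton_le_iff_mem _).2 <| Ideal.mem_span_singleton'.2 ⟨j (1 - f), by
      rw [← map_mul, sub_mul, one_mul, mul_sub, mul_one, hcomm, sub_sub_sub_cancel_right]⟩
  have hS : f' ∈ S := ⟨hfc', hfi', hf0', by rw [← hff', mul_assoc, hfe]⟩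
  obtain ⟨a, ha⟩ := Ideal.mem_span_singleton'.1 <|
    (Ideal.span_singleton_le_iff_mem _).1 (hmax hS hle)
  have hzero : (1 - f') * f = 0 := hj <| by
    rw [map_mul, ← ha, mul_assoc, ← map_mul, hfi.one_sub_mul_self, map_zero, mul_zero]
  rw [sub_mul, one_mul, hff', sub_eq_zero] at hzero
  exact hzero.symm

end Idempotents

section OrbitSum

/-- The sum of the orbit of `x` under `H` (zero if the orbit is infinite). For a block `b` it is the
trace `Tr(H, b)`. -/
noncomputable def orbitSum (H : Type*) {M : Type*} [Group H] [AddCommMonoid M] [MulAction H M]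
    (x : M) : M :=
  ∑ᶠ y ∈ MulAction.orbit H x, y

variable {H P M : Type*} [Group H] [MulAction H P]

theorem orbitSum_eq_self [AddCommMonoid M] [MulAction H M] {x : M} (hx : ∀ h : H, h • x = x) :
    orbitSum H x = x := by
  have horbit : MulAction.orbit H x = {x} :=
    Set.eq_singleton_iff_unique_mem.2 ⟨MulAction.mem_orbit_self x, fun _ ⟨h, hy⟩ => hy ▸ hx h⟩
  rw [orbitSum, horbit, finsum_mem_singleton]

theorem orbitSum_apply [AddCommMonoid M] [MulAction H M] {v : P →[H] M}
    (hv : Function.Injective v) (p : P) :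
    orbitSum H (v p) = ∑ᶠ q ∈ MulAction.orbit H p, v q := by
  have horbit : MulAction.orbit H (v p) = v '' MulAction.orbit H p := by
    rw [MulAction.orbit, MulAction.orbit, ← Set.range_comp]
    exact congrArg Set.range (funext fun h => (map_smul v h p).symm)
  rw [orbitSum, horbit, finsum_mem_image hv.injOn]

theorem smul_orbitSum [AddCommMonoid M] [DistribMulAction H M] [Finite H] (h : H) (x : M) :
    h • orbitSum H x = orbitSum H x :=
  calc h • orbitSum H x = ∑ᶠ y ∈ MulAction.orbit H x, h • y :=
        (DistribSMul.toAddMonoidHom M h).map_finsum_mem _ (Finite.finite_mulAction_orbit x)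
    _ = orbitSum H x := finsum_mem_eq_of_bijOn (h • ·)
        ⟨MulAction.mapsTo_smul_orbit h x, (MulAction.injective h).injOn, fun y hy =>
          ⟨h⁻¹ • y, MulAction.mapsTo_smul_orbit h⁻¹ x hy, smul_inv_smul h y⟩⟩ fun _ _ => rfl

theorem finsum_ofQuotientStabilizer [AddCommMonoid M] (v : P → M) (p : P) :
    ∑ᶠ q : H ⧸ MulAction.stabilizer H p, v (MulAction.ofQuotientStabilizer H p q) =
      ∑ᶠ q ∈ MulAction.orbit H p, v q := by
  rw [← finsum_mem_univ]
  refine finsum_mem_eq_of_bijOn (MulAction.ofQuotientStabilizer H p)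
    ⟨fun q _ => MulAction.ofQuotientStabilizer_mem_orbit H p q,
      (MulAction.injective_ofQuotientStabilizer H p).injOn, ?_⟩ fun _ _ => rfl
  rintro _ ⟨h, rfl⟩
  exact ⟨h, trivial, MulAction.ofQuotientStabilizer_mk H p h⟩

variable {R : Type*} [Ring R] [MulSemiringAction H R] {b c e : R}

theorem IsBlock.smul (hb : IsBlock b) (h : H) : IsBlock (h • b) :=
  hb.map_equiv (MulSemiringAction.toRingEquiv H R h)

theorem IsBlock.orbitSum_mem_center (hb : IsBlock b) : orbitSum H b ∈ Set.center R :=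
  finsum_mem_induction (· ∈ Set.center R) Set.zero_mem_center (fun _ _ => Set.add_mem_center)
    (by rintro _ ⟨h, rfl⟩; exact (hb.smul h).central)

variable [Finite H]

theorem orbitSum_mul_eq_self (hfix : ∀ h : H, h • e = e) (hbe : b * e = b) :
    orbitSum H b * e = orbitSum H b := by
  rw [orbitSum, finsum_mem_mul' _ _ (Finite.finite_mulAction_orbit b)]
  refine finsum_mem_congr rfl ?_
  rintro _ ⟨h, rfl⟩
  change h • b * e = h • b
  rw [← hfix h, ← smul_mul', hbe]

theorem IsBlock.mul_orbitSum_of_mem (hb : IsBlock b) (hcb : c ∈ MulAction.orbit H b) :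
    c * orbitSum H b = c := by
  have block_of_mem {y : R} (hy : y ∈ MulAction.orbit H b) : IsBlock y := by
    obtain ⟨h, rfl⟩ := hy
    exact hb.smul h
  rw [orbitSum, mul_finsum_mem' _ _ (Finite.finite_mulAction_orbit b),
    finsum_eq_single _ c fun y hyc => ?_]
  · simp only [hcb, finsum_true, (block_of_mem hcb).idem]
  · exact (finsum_congr fun hy =>
      (block_of_mem hcb).mul_eq_zero_of_ne (block_of_mem hy) hyc.symm).trans finsum_zero

theorem IsBlock.mul_orbitSum_of_notMem (hb : IsBlock b) (hc : IsBlock c)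
    (hcb : c ∉ MulAction.orbit H b) : c * orbitSum H b = 0 := by
  rw [orbitSum, mul_finsum_mem' _ _ (Finite.finite_mulAction_orbit b)]
  refine finsum_mem_eq_zero_of_forall_eq_zero fun y hy => ?_
  have hcy : c ≠ y := fun h => hcb (h ▸ hy)
  obtain ⟨h, rfl⟩ := hy
  exact hc.mul_eq_zero_of_ne (hb.smul h) hcy

theorem IsBlock.mul_orbitSum_self (hb : IsBlock b) : b * orbitSum H b = b :=
  hb.mul_orbitSum_of_mem (MulAction.mem_orbit_self b)

theorem IsBlock.isIdempotentElem_orbitSum (hb : IsBlock b) : IsIdempotentElem (orbitSum H b) :=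
  orbitSum_mul_eq_self (fun h => smul_orbitSum h b) hb.mul_orbitSum_self

theorem IsBlock.orbitSum_ne_zero (hb : IsBlock b) : orbitSum H b ≠ 0 :=
  right_ne_zero_of_mul (hb.mul_orbitSum_self.trans_ne hb.ne_zero)

theorem IsBlock.orbitSum_eq_iff (hb : IsBlock b) (hc : IsBlock c) :
    orbitSum H b = orbitSum H c ↔ b ∈ MulAction.orbit H c := by
  refine ⟨fun h => of_not_not fun hbc => hb.ne_zero ?_, fun h => ?_⟩
  · rw [← hb.mul_orbitSum_self (H := H), h, hc.mul_orbitSum_of_notMem hb hbc]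
  · rw [orbitSum, MulAction.orbit_eq_iff.2 h, orbitSum]

theorem IsBlock.orbitSum_mul_eq_zero_or (hb : IsBlock b) (he : e ∈ Set.center R)
    (hi : IsIdempotentElem e) (hfix : ∀ h : H, h • e = e) :
    orbitSum H b * e = 0 ∨ orbitSum H b * e = orbitSum H b := by
  refine (hb.mul_eq_zero_or_mul_eq_self he hi).imp (fun h => ?_) (orbitSum_mul_eq_self hfix)
  have hcompl : orbitSum H b * (1 - e) = orbitSum H b := orbitSum_mul_eq_self
    (fun h => by rw [smul_sub, smul_one, hfix]) (by rw [mul_sub, mul_one, h, sub_zero])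
  rwa [mul_sub, mul_one, sub_eq_self] at hcompl

end OrbitSum

section Invariants

variable {H R S : Type*} [Group H] [Finite H] [Ring R] [MulSemiringAction H R] [SetLike S R]
  [SubringClass S R] {F : S}

theorem IsBlock.isBlock_of_coe_eq_orbitSum
    (hF : ∀ x, x ∈ F ↔ x ∈ Set.center R ∧ ∀ h : H, h • x = x) {b : R} (hb : IsBlock b) {f : F}
    (hf : (f : R) = orbitSum H b) : IsBlock f := by
  have coe_central (x : F) : (x : R) ∈ Set.center R := ((hF x).1 x.2).1
  refine ⟨Subtype.ext ?_, ?_, fun h => ?_, fun e₁ e₂ _ _ i₁ _ horth hsum => ?_⟩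
  · change (f : R) * f = f
    rw [hf, hb.isIdempotentElem_orbitSum]
  · exact Semigroup.mem_center_iff.2 fun x =>
      Subtype.ext ((Set.mem_center_iff.1 (coe_central f)).comm x).symm
  · exact hb.orbitSum_ne_zero (H := H) (hf.symm.trans (congrArg Subtype.val h))
  · have hfe : f * e₁ = e₁ := by
      have hcomm : e₂ * e₁ = e₁ * e₂ :=
        Subtype.ext ((Set.mem_center_iff.1 (coe_central e₂)).comm e₁)
      rw [hsum, add_mul, i₁, hcomm, horth, add_zero]
    have hfe' : orbitSum H b * (e₁ : R) = e₁ := hf ▸ congrArg Subtype.val hfe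
    refine (hb.orbitSum_mul_eq_zero_or (coe_central e₁) (congrArg Subtype.val i₁)
      ((hF e₁).1 e₁.2).2).imp (fun h => Subtype.ext (hfe'.symm.trans h)) fun h => ?_
    have he₁ : e₁ = f := Subtype.ext (hfe'.symm.trans (h.trans hf.symm))
    exact left_eq_add.1 (he₁.trans hsum)

theorem isBlock_iff_coe_eq_orbitSum (hR : BlockAtomic R)
    (hF : ∀ x, x ∈ F ↔ x ∈ Set.center R ∧ ∀ h : H, h • x = x) {f : F} :
    IsBlock f ↔ ∃ b : R, IsBlock b ∧ (f : R) = orbitSum H b := by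
  refine ⟨fun hf => ?_, fun ⟨b, hb, h⟩ => hb.isBlock_of_coe_eq_orbitSum hF h⟩
  obtain ⟨b, hb, hbf⟩ := hR f ((hF f).1 f.2).1 (congrArg Subtype.val hf.idem)
    (fun h => hf.ne_zero (Subtype.ext h))
  let s : F := ⟨orbitSum H b, (hF _).2 ⟨hb.orbitSum_mem_center, fun h => smul_orbitSum h b⟩⟩
  have hs : IsBlock s := hb.isBlock_of_coe_eq_orbitSum hF rfl
  have hsf : s * f = s := Subtype.ext (orbitSum_mul_eq_self ((hF f).1 f.2).2 hbf)
  refine ⟨b, hb, congrArg Subtype.val (of_not_not fun hne => hs.ne_zero ?_ : f = s)⟩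
  rw [← hsf, hs.mul_eq_zero_of_ne hf (Ne.symm hne)]

theorem image_isBlock_eq_of_forall_smul_eq (hR : BlockAtomic R)
    (hF : ∀ x, x ∈ F ↔ x ∈ Set.center R ∧ ∀ h : H, h • x = x)
    (hfix : ∀ b : R, IsBlock b → ∀ h : H, h • b = b) :
    (fun f : F => (f : R)) '' {f | IsBlock f} = {b | IsBlock b} := by
  ext b
  constructor
  · rintro ⟨f, hf, rfl⟩
    obtain ⟨b, hb, hfb⟩ := (isBlock_iff_coe_eq_orbitSum hR hF).1 hf
    change IsBlock (f : R)
    rwa [hfb, orbitSum_eq_self (hfix b hb)]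
  · intro hb
    refine ⟨⟨b, (hF b).2 ⟨hb.central, hfix b hb⟩⟩, ?_, rfl⟩
    exact hb.isBlock_of_coe_eq_orbitSum hF (orbitSum_eq_self (hfix b hb)).symm

theorem exists_orbit_equiv_blocks (hR : BlockAtomic R)
    (hF : ∀ x, x ∈ F ↔ x ∈ Set.center R ∧ ∀ h : H, h • x = x) {P : Type*} [MulAction H P]
    {v : P →[H] R} (hv : Function.Injective v) (hrange : Set.range v = {b | IsBlock b}) :
    ∃ Ψ : MulAction.orbitRel.Quotient H P ≃ {f : F // IsBlock f},
      ∀ Y, ((Ψ Y : F) : R) = ∑ᶠ p ∈ Y.orbit, v p := by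
  have hblock (p : P) : IsBlock (v p) := hrange.le ⟨p, rfl⟩
  let s (p : P) : F := ⟨orbitSum H (v p),
    (hF _).2 ⟨(hblock p).orbitSum_mem_center, fun h => smul_orbitSum h _⟩⟩
  let t (p : P) : {f : F // IsBlock f} := ⟨s p, (hblock p).isBlock_of_coe_eq_orbitSum hF rfl⟩
  have ht : Function.Surjective t := fun ⟨f, hf⟩ => by
    obtain ⟨b, hb, hfb⟩ := (isBlock_iff_coe_eq_orbitSum hR hF).1 hf
    obtain ⟨p, rfl⟩ := hrange.ge hb
    exact ⟨p, Subtype.ext (Subtype.ext hfb.symm)⟩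
  have hker (p q : P) : MulAction.orbitRel H P p q ↔ Setoid.ker t p q := by
    have mem_orbit_iff : v p ∈ MulAction.orbit H (v q) ↔ p ∈ MulAction.orbit H q :=
      exists_congr fun h => by rw [← hv.eq_iff, map_smul]
    rw [Setoid.ker_def, Subtype.ext_iff, Subtype.ext_iff, MulAction.orbitRel_apply,
      ← mem_orbit_iff]
    exact ((hblock p).orbitSum_eq_iff (hblock q)).symm
  refine ⟨(Quotient.congrRight hker).trans (Setoid.quotientKerEquivOfSurjective t ht), fun Y => ?_⟩
  induction Y using Quotient.inductionOn' with
  | h p => exact orbitSum_apply hv p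

end Invariants

theorem BlockAtomic.of_finite_of_flat (O : Type*) {R B : Type*} [CommRing O] [IsDomain O] [Ring R]
    [Ring B] [Algebra O B] [Module.Finite O B] [Module.Flat O B] {j : R →+* B}
    (hj : Function.Injective j) : BlockAtomic R := by
  let K := FractionRing O
  have : IsNoetherianRing (K ⊗[O] B) := IsNoetherianRing.of_finite K (K ⊗[O] B)
  let ι : B →ₐ[O] K ⊗[O] B := Algebra.TensorProduct.includeRight
  have hι : Function.Injective ι :=
    Algebra.TensorProduct.includeRight_injective (IsFractionRing.injective O K)
  exact BlockAtomic.of_injective (j := (ι : B →+* K ⊗[O] B).comp j) (hι.comp hj)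

section Characters

theorem IsSplitSemisimple.exists_algHom_ne_zero {K B : Type*} [Field K] [CommRing B] [Algebra K B]
    (h : IsSplitSemisimple K B) {x : B} (hx : x ≠ 0) : ∃ φ : B →ₐ[K] K, φ x ≠ 0 := by
  have := h.1
  obtain ⟨m, hm, hxm⟩ : ∃ m : Ideal B, m.IsMaximal ∧ x ∉ m := by
    have hrad : x ∉ Ring.jacobson B := by
      rw [IsSemisimpleRing.jacobson_eq_bot]
      exact hx
    rw [Ring.jacobson_eq_sInf_isMaximal, Submodule.mem_sInf] at hrad
    push Not at hrad
    exact hrad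
  have : IsSimpleModule B (B ⧸ m) := isSimpleModule_iff_isCoatom.2 hm.out
  obtain ⟨ε⟩ := h.2 (B ⧸ m)
  refine ⟨(ε : Module.End B (B ⧸ m) →ₐ[K] K).comp (Algebra.lsmul K B (B ⧸ m)), fun h0 => ?_⟩
  have hsmul : Algebra.lsmul K B (B ⧸ m) x = 0 := ε.injective (h0.trans (map_zero ε).symm)
  have hmk : Ideal.Quotient.mk m x = 0 := by
    simpa [Algebra.smul_def] using congrArg (fun f : Module.End B (B ⧸ m) => f 1) hsmul
  exact hxm (Ideal.Quotient.eq_zero_iff_mem.1 hmk)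

theorem exists_monoidHom_ne_one {K G : Type*} [Field K] [CommGroup G]
    (hG : IsSplitSemisimple K (MonoidAlgebra K G)) {g : G} (hg : g ≠ 1) :
    ∃ ξ : G →* Kˣ, ξ g ≠ 1 := by
  have hne : MonoidAlgebra.of K G g - 1 ≠ 0 := by
    rw [sub_ne_zero, ← map_one (MonoidAlgebra.of K G)]
    exact fun h => hg (MonoidAlgebra.of_injective h)
  obtain ⟨φ, hφ⟩ := hG.exists_algHom_ne_zero hne
  refine ⟨((φ : MonoidAlgebra K G →* K).comp (MonoidAlgebra.of K G)).toHomUnits, fun h => hφ ?_⟩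
  rw [map_sub, map_one, sub_eq_zero]
  exact congrArg Units.val h

end Characters

theorem mem_iff_forall_decompose_eq_zero {ι M σ : Type*} [DecidableEq ι] [AddCommMonoid M]
    [SetLike σ M] [AddSubmonoidClass σ M] (ℳ : ι → σ) [DirectSum.Decomposition ℳ] {x : M} {i : ι} :
    x ∈ ℳ i ↔ ∀ j ≠ i, DirectSum.decompose ℳ x j = 0 := by
  refine ⟨fun hx j hj => ?_, fun hx => ?_⟩
  · rw [DirectSum.decompose_of_mem _ hx, DirectSum.of_eq_of_ne _ _ _ hj]
  · classical
    rw [← DirectSum.sum_support_decompose ℳ x]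
    refine sum_mem fun j _ => ?_
    obtain rfl | hj := eq_or_ne j i
    · exact SetLike.coe_mem _
    · rw [hx j hj]
      exact zero_mem _

namespace TwistedSymmetricAlgebra

variable {O K G A : Type*} [CommRing O] [Group G] [DecidableEq G] [Ring A] [Algebra O A]
  (D : TwistedSymmetricAlgebra O G A)

include D in
theorem module_free : Module.Free O A :=
  have := D.symmetric_bar.free
  have := D.symmetric_bar.free_left
  Module.Free.trans (S := D.bar)

include D in
theorem module_finite : Module.Finite O A :=
  have := D.symmetric_bar.finite
  have := D.symmetric_bar.finite_left
  Module.Finite.trans D.bar A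

include D in
theorem blockAtomic [IsDomain O] : BlockAtomic A :=
  have := D.module_free
  have := D.module_finite
  BlockAtomic.of_finite_of_flat O (j := RingHom.id A) Function.injective_id

theorem blockAtomic_center_bar [IsDomain O] : BlockAtomic (Subalgebra.center O D.bar) :=
  have := D.symmetric_bar.free
  have := D.symmetric_bar.finite
  BlockAtomic.of_finite_of_flat O (j := (Subalgebra.center O D.bar).val.toRingHom)
    Subtype.val_injective

theorem coe_mem_center_iff {z : Subalgebra.center O D.bar} :
    ((z : D.bar) : A) ∈ Subalgebra.center O A ↔ z ∈ D.fixedBar := by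
  constructor
  · intro hz g
    obtain ⟨u, hu⟩ := D.exists_unit g
    exact D.act_unique hu (Subalgebra.mem_center_iff.1 hz u).symm
  · intro hz
    refine Subalgebra.mem_center_iff.2 fun x => ?_
    induction x using D.comp_induction with
    | h0 => rw [zero_mul, mul_zero]
    | hadd x y hx hy => rw [add_mul, mul_add, hx, hy]
    | hc g x hx =>
      have hact := D.act_mul z hx
      rw [show D.act g z = z from hz g] at hact
      exact hact.symm

theorem barTr_eq_finsum_orbit (b : D.BarBlocks) : D.barTr b = ∑ᶠ c ∈ MulAction.orbit G b, c.val :=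
  finsum_ofQuotientStabilizer BarBlocks.val b

theorem exists_barOrbit_equiv_blocks [IsDomain O] [Finite G] :
    ∃ Ψ : MulAction.orbitRel.Quotient G D.BarBlocks ≃ {f : D.fixedBar // IsBlock f},
      ∀ Y, ((((Ψ Y : D.fixedBar) : Subalgebra.center O D.bar) : D.bar) : A) =
        ∑ᶠ b ∈ Y.orbit, b.val := by
  let v : D.BarBlocks →[G] Subalgebra.center O D.bar := ⟨BarBlocks.toCenter, fun _ _ => rfl⟩
  have hv : Function.Injective v := fun _ _ h =>
    Subtype.ext (congrArg (fun z : Subalgebra.center O D.bar => (z : D.bar)) h)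
  have hrange : Set.range v = {z | IsBlock z} := Set.ext fun z =>
    ⟨fun ⟨b, hb⟩ => isBlock_coe_center_iff.1 (hb ▸ b.2),
      fun hz => ⟨⟨z, isBlock_coe_center_iff.2 hz⟩, rfl⟩⟩
  have hF (z) : z ∈ D.fixedBar ↔ z ∈ Set.center _ ∧ ∀ g : G, g • z = z := by
    rw [Set.center_eq_univ]
    exact (and_iff_right trivial).symm
  obtain ⟨Ψ, hΨ⟩ := exists_orbit_equiv_blocks D.blockAtomic_center_bar hF hv hrange
  refine ⟨Ψ, fun Y => ?_⟩
  have hfin : Y.orbit.Finite := by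
    induction Y using Quotient.inductionOn' with
    | h b => exact Finite.finite_mulAction_orbit b
  rw [hΨ]
  exact (D.bar.val.comp (Subalgebra.center O D.bar).val).toAddMonoidHom.map_finsum_mem v hfin

section Dual

variable [IsIntegrallyClosed O] [Field K] [Algebra O K] [IsFractionRing O K] [Finite G]

theorem decompose_dualLin [DirectSum.Decomposition D.comp] (ξ : G →* Kˣ) (a : A) (g : G) :
    DirectSum.decompose D.comp (D.dualLin ξ a) g =
      charVal O ξ g • DirectSum.decompose D.comp a g := by
  induction a using D.comp_induction with
  | h0 => simp
  | hadd a b ha hb =>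
    simp only [map_add, DirectSum.decompose_add, DirectSum.add_apply, ha, hb, smul_add]
  | hc h a ha =>
    rw [D.dualLin_apply ξ ha, DirectSum.decompose_smul, DirectSum.smul_apply,
      DirectSum.decompose_of_mem _ ha]
    obtain rfl | hgh := eq_or_ne g h
    · rfl
    · rw [DirectSum.of_eq_of_ne _ _ _ hgh, smul_zero, smul_zero]

theorem topTr_eq_finsum_orbit (b : D.Blocks) :
    D.topTr K b = ∑ᶠ c ∈ MulAction.orbit (G →* Kˣ) b, c.val :=
  finsum_ofQuotientStabilizer Blocks.val b

variable (K) in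
/-- The action of `G^∨ = Hom(G, Kˣ)` on `A` by ring automorphisms. It is not an instance because it
depends on the grading recorded in `D`. -/
noncomputable abbrev dualMulSemiringAction : MulSemiringAction (G →* Kˣ) A where
  smul ξ := D.dualAct ξ
  one_smul := D.dualLin_one_char
  mul_smul := D.dualLin_mul_char
  smul_zero ξ := map_zero (D.dualAct ξ)
  smul_add ξ := map_add (D.dualAct ξ)
  smul_one ξ := map_one (D.dualAct ξ)
  smul_mul ξ := map_mul (D.dualAct ξ)

variable [IsDomain O]

theorem exists_topOrbit_equiv_blocks :
    ∃ Ψ : MulAction.orbitRel.Quotient (G →* Kˣ) D.Blocks ≃ {f : D.fixedTop K // IsBlock f},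
      ∀ Y, ((Ψ Y : D.fixedTop K) : A) = ∑ᶠ b ∈ Y.orbit, b.val := by
  let := D.dualMulSemiringAction K
  let v : D.Blocks →[G →* Kˣ] A := ⟨Blocks.val, fun _ _ => rfl⟩
  exact exists_orbit_equiv_blocks D.blockAtomic (F := D.fixedTop K) (fun _ => Iff.rfl)
    (v := v) Subtype.val_injective Subtype.range_coe

theorem image_isBlock_fixedTop_eq_of_forall_smul_eq
    (hfix : ∀ (ξ : G →* Kˣ) (b : D.Blocks), ξ • b = b) :
    (fun z : D.fixedTop K => (z : A)) '' {z | IsBlock z} = {b : A | IsBlock b} := by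
  let := D.dualMulSemiringAction K
  exact image_isBlock_eq_of_forall_smul_eq (H := G →* Kˣ) D.blockAtomic (fun _ => Iff.rfl)
    fun b hb ξ => congrArg Subtype.val (hfix ξ ⟨b, hb⟩)

variable (hsep : ∀ g : G, g ≠ 1 → ∃ ξ : G →* Kˣ, ξ g ≠ 1)

include hsep

theorem forall_dualAct_eq_iff {a : A} : (∀ ξ : G →* Kˣ, D.dualAct ξ a = a) ↔ a ∈ D.bar := by
  rw [← D.mem_comp_one]
  refine ⟨fun hfix => ?_, fun ha ξ => ?_⟩
  · have := D.module_free
    let : DirectSum.Decomposition D.comp := D.internal.chooseDecomposition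
    refine (mem_iff_forall_decompose_eq_zero D.comp).2 fun g hg => ?_
    obtain ⟨ξ, hξ⟩ := hsep g hg
    have hchar : charVal O ξ g - 1 ≠ 0 := fun h => hξ <| Units.ext <| by
      rw [← algebraMap_charVal (O := O), sub_eq_zero.1 h, map_one, Units.val_one]
    have hscale : charVal O ξ g • DirectSum.decompose D.comp a g = DirectSum.decompose D.comp a g :=
      (D.decompose_dualLin ξ a g).symm.trans (by rw [show D.dualLin ξ a = a from hfix ξ])
    have hzero : (charVal O ξ g - 1) • (DirectSum.decompose D.comp a g : A) = 0 := by
      rw [sub_smul, one_smul, sub_eq_zero]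
      exact congrArg Subtype.val hscale
    exact Subtype.ext ((smul_eq_zero.1 hzero).resolve_left hchar)
  · change D.dualLin ξ a = a
    rw [D.dualLin_apply ξ ha, charVal_one, one_smul]

theorem mem_fixedTop_iff {a : A} :
    a ∈ D.fixedTop K ↔ a ∈ Subalgebra.center O A ∧ a ∈ D.bar :=
  and_congr_right fun _ => D.forall_dualAct_eq_iff hsep

omit hsep in
/-- The identification of `(ZĀ)^G` with `(ZA)^{G^∨}`: both consist of the elements of `Ā` which are
central in `A`. -/
def fixedEquiv (hsep : ∀ g : G, g ≠ 1 → ∃ ξ : G →* Kˣ, ξ g ≠ 1) :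
    D.fixedBar ≃ₐ[O] D.fixedTop K where
  toFun z := ⟨((z : Subalgebra.center O D.bar) : D.bar),
    (D.mem_fixedTop_iff hsep).2 ⟨D.coe_mem_center_iff.2 z.2, z.1.1.2⟩⟩
  invFun a :=
    have ha := (D.mem_fixedTop_iff hsep).1 a.2
    ⟨⟨⟨a, ha.2⟩, Subalgebra.mem_center_iff.2 fun w =>
      Subtype.ext (Subalgebra.mem_center_iff.1 ha.1 w)⟩, D.coe_mem_center_iff.1 ha.1⟩
  left_inv _ := rfl
  right_inv _ := rfl
  map_mul' _ _ := rfl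
  map_add' _ _ := rfl
  commutes' _ := rfl

theorem image_isBlock_fixedBar_eq :
    (fun z : D.fixedBar => (((z : Subalgebra.center O D.bar) : D.bar) : A)) '' {z | IsBlock z} =
      (fun z : D.fixedTop K => (z : A)) '' {z | IsBlock z} := by
  let σ := (D.fixedEquiv hsep).toRingEquiv
  ext a
  constructor
  · rintro ⟨z, hz, rfl⟩
    exact ⟨σ z, (isBlock_ringEquiv_iff σ).2 hz, rfl⟩
  · rintro ⟨z, hz, rfl⟩
    exact ⟨σ.symm z, (isBlock_ringEquiv_iff σ.symm).2 hz, rfl⟩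

end Dual

end TwistedSymmetricAlgebra

theorem mainTheorem9_general {O K G A : Type*} [CommRing O] [IsDomain O] [IsIntegrallyClosed O]
    [Field K] [Algebra O K] [IsFractionRing O K] [Group G] [DecidableEq G] [Finite G]
    [Ring A] [Algebra O A] (D : TwistedSymmetricAlgebra O G A)
    (hsep : ∀ g : G, g ≠ 1 → ∃ ξ : G →* Kˣ, ξ g ≠ 1) :
    (∃ Φ : MulAction.orbitRel.Quotient G D.BarBlocks ≃
          MulAction.orbitRel.Quotient (G →* Kˣ) D.Blocks,
      ∀ Y : MulAction.orbitRel.Quotient G D.BarBlocks,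
        (∑ᶠ b ∈ Y.orbit, b.val) = (∑ᶠ b ∈ (Φ Y).orbit, b.val) ∧
        ∀ b' ∈ Y.orbit, ∀ b ∈ (Φ Y).orbit, D.barTr b' = D.topTr K b) ∧
    (fun z : D.fixedBar => (((z : Subalgebra.center O D.bar) : D.bar) : A)) '' {z | IsBlock z} =
      (fun z : D.fixedTop K => (z : A)) '' {z | IsBlock z} ∧
    ((∀ (ξ : G →* Kˣ) (b : D.Blocks), ξ • b = b) →
      {b : A | IsBlock b} =
        (fun z : D.fixedBar => (((z : Subalgebra.center O D.bar) : D.bar) : A)) ''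
          {z | IsBlock z}) := by
  obtain ⟨Ψ, hΨ⟩ := D.exists_barOrbit_equiv_blocks
  obtain ⟨Θ, hΘ⟩ := D.exists_topOrbit_equiv_blocks (K := K)
  have himage := D.image_isBlock_fixedBar_eq hsep
  let σ : {f : D.fixedBar // IsBlock f} ≃ {f : D.fixedTop K // IsBlock f} :=
    (D.fixedEquiv hsep).toEquiv.subtypeEquiv
      fun _ => (isBlock_ringEquiv_iff (D.fixedEquiv hsep).toRingEquiv).symm
  let Φ := (Ψ.trans σ).trans Θ.symm
  have hΦ Y : ∑ᶠ b ∈ Y.orbit, b.val = ∑ᶠ b ∈ (Φ Y).orbit, b.val := by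
    rw [← hΨ, ← hΘ, Equiv.trans_apply, Equiv.apply_symm_apply]
    rfl
  refine ⟨⟨Φ, fun Y => ⟨hΦ Y, fun b' hb' b hb => ?_⟩⟩, himage, fun hfix => ?_⟩
  · rw [D.barTr_eq_finsum_orbit, D.topTr_eq_finsum_orbit,
      ← MulAction.orbitRel.Quotient.orbit_mk, ← MulAction.orbitRel.Quotient.orbit_mk,
      MulAction.orbitRel.Quotient.mem_orbit.1 hb', MulAction.orbitRel.Quotient.mem_orbit.1 hb]
    exact hΦ Y
  · rw [himage, D.image_isBlock_fixedTop_eq_of_forall_smul_eq hfix]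

theorem mainTheorem9 {O K G A : Type*}
    [CommRing O] [IsDomain O] [IsNoetherianRing O] [IsIntegrallyClosed O]
    [Field K] [Algebra O K] [IsFractionRing O K]
    [Group G] [DecidableEq G] [Finite G] [IsCyclic G]
    [Ring A] [Algebra O A] [Module.Free O A] [Module.Finite O A]
    (D : TwistedSymmetricAlgebra O G A)
    (hA : IsSplitSemisimple K (K ⊗[O] A))
    (hbar : IsSplitSemisimple K (K ⊗[O] D.bar))
    (hG : IsSplitSemisimple K (MonoidAlgebra K G)) :
    (∃ Φ : MulAction.orbitRel.Quotient G D.BarBlocks ≃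
          MulAction.orbitRel.Quotient (G →* Kˣ) D.Blocks,
      ∀ Y : MulAction.orbitRel.Quotient G D.BarBlocks,
        (∑ᶠ b ∈ Y.orbit, b.val) = (∑ᶠ b ∈ (Φ Y).orbit, b.val) ∧
        ∀ b' ∈ Y.orbit, ∀ b ∈ (Φ Y).orbit, D.barTr b' = D.topTr K b) ∧
    (fun z : D.fixedBar => (((z : Subalgebra.center O D.bar) : D.bar) : A)) '' {z | IsBlock z} =
      (fun z : D.fixedTop K => (z : A)) '' {z | IsBlock z} ∧
    ((∀ (ξ : G →* Kˣ) (b : D.Blocks), ξ • b = b) →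
      {b : A | IsBlock b} =
        (fun z : D.fixedBar => (((z : Subalgebra.center O D.bar) : D.bar) : A)) ''
          {z | IsBlock z}) := by
  let : CommGroup G := IsCyclic.commGroup
  exact mainTheorem9_general D fun g hg => exists_monoidHom_ne_one hG hg
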